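/- Conventions. Let $G$ be a locally compact abelian group with Haar measure $\mu$. A set $\Omega\subseteq G$ of finite measure is spectral if there is a set $\Lambda$ of continuous unitary characters of $G$ (a spectrum of $\Omega$) that forms an orthogonal basis of $L^2(\Omega,\mu)$. It tiles $G$ if there is a set $T\subseteq G$ with $\sum_{t\in T}\chi_\Omega(x-t)=1$ for $\mu$-almost every $x\in G$. The groups $\mathbb Z_8^3$ and $\mathbb Z^3$ carry counting measure, and $\mathbb R^3$ carries Lebesgue measure. A real $k\times k$ matrix $(h_{i,j})$ is log-Hadamard if $U=(e^{2\pi i h_{i,j}})$ is a complex Hadamard matrix, i.e. it has unimodular entries and $UU^*=kI$. Put $$H=\frac18\begin{pmatrix}0&0&0&0&0&0\\0&4&2&6&6&2\\0&2&4&1&5&6\\0&6&3&4&2&7\\0&6&7&2&4&3\\0&2&6&5&1&4\end{pmatrix},\quad A=\begin{pmatrix}0&2&4&1&5&6\\0&6&3&4&2&7\\0&6&7&2&4&3\end{pmatrix},\quad L=\begin{pmatrix}0&0&0\\0&1&1\\1&0&0\\0&1&0\\0&0&1\\7&1&1\end{pmatrix}.$$ Theorem (the direction "spectral $\Rightarrow$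 tile" of the Spectral Set Conjecture is false in dimension 3). 1. $H$ is log-Hadamard, and $8H\equiv LA \pmod 8$. 2. Identify $A$ with the set of its columns in $\mathbb Z_8^3$. This set has exactly $6$ elements, while $|\mathbb Z_8^3|=512$ and $6\nmid 512$. The six characters $x\mapsto e^{2\pi i\langle l,x\rangle/8}$, where $l$ runs over the rows of $L$, are distinct and form a spectrum of $A$ in $\mathbb Z_8^3$; in particular $A$ is spectral. The set $A$ does not tile $\mathbb Z_8^3$. 3. For every integer $n\ge 1$ the set $A_n=A+8\,\{0,1,\dots,n-1\}^3\subset\mathbb Z^3$, where $A$ now denotes the set of columns of the above integer matrix, is spectral in $\mathbb Z^3$. 4. There is $N\ge 1$ such that for all $n\ge N$ the set $A_n$ does not tile $\mathbb Z^3$, and the finite union of unit cubes $\Omega=A_n+[0,1)^3$ is spectral in $\mathbb R^3$ but does not tile $\mathbb R^3$. 5. Consequently there is a nonempty bounded open set $\Omega\subset\mathbb R^3$ that is spectral but does not tile $\mathbb R^3$. -/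

import Mathlib

open MeasureTheory Matrix
open scoped ENNReal ComplexConjugate Matrix

/-- A real square matrix `h` is log-Hadamard if `(e^{2π i h_{m,j}})` is a complex
Hadamard matrix (unimodular entries, and `H Hᴴ = k I`). -/
def IsLogHadamard {k : ℕ} (h : Matrix (Fin k) (Fin k) ℝ) : Prop :=
  Matrix.IsHadamard
    (Matrix.of fun m j => Complex.exp (2 * (Real.pi : ℂ) * Complex.I * (h m j : ℂ)))

/-- A set `Λ` of continuous unitary characters of `G` is a spectrum of `Ω` (with respect to the
Haar measure `μ`) if the characters form an orthogonal basis of `L²(Ω, μ)`: they lie in `L²(Ω, μ)`,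
are pairwise orthogonal there, and their linear span is dense. -/
structure IsSpectrum {G : Type*} [AddCommGroup G] [TopologicalSpace G] [MeasurableSpace G]
    (μ : Measure G) (Ω : Set G) (Λ : Set (AddChar G Circle)) : Prop where
  continuous_char : ∀ χ ∈ Λ, Continuous (fun x => χ x)
  memLp : ∀ χ ∈ Λ, MemLp (fun x => (χ x : ℂ)) 2 (μ.restrict Ω)
  orthogonal : ∀ χ ∈ Λ, ∀ ψ ∈ Λ, χ ≠ ψ → ∫ x in Ω, (χ x : ℂ) * conj (ψ x : ℂ) ∂μ = 0
  dense_span : (Submodule.span ℂ {f : Lp ℂ 2 (μ.restrict Ω) |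
    ∃ χ ∈ Λ, f =ᵐ[μ.restrict Ω] fun x => (χ x : ℂ)}).topologicalClosure = ⊤

/-- `Ω` is spectral if it has a spectrum. -/
def IsSpectral {G : Type*} [AddCommGroup G] [TopologicalSpace G] [MeasurableSpace G]
    (μ : Measure G) (Ω : Set G) : Prop :=
  ∃ Λ : Set (AddChar G Circle), IsSpectrum μ Ω Λ

/-- `Ω` tiles `G` by translation: for some set `T` of translates,
`∑_{t ∈ T} χ_Ω(x - t) = 1` for almost every `x`. -/
def Tiles {G : Type*} [AddCommGroup G] [MeasurableSpace G] (μ : Measure G) (Ω : Set G) : Prop :=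
  ∃ T : Set G, ∀ᵐ x ∂μ, ∑' t : T, Ω.indicator (fun _ => (1 : ℝ≥0∞)) (x - (t : G)) = 1

/-- The matrix `8H`. -/
def matK : Matrix (Fin 6) (Fin 6) ℤ :=
  !![0, 0, 0, 0, 0, 0;
     0, 4, 2, 6, 6, 2;
     0, 2, 4, 1, 5, 6;
     0, 6, 3, 4, 2, 7;
     0, 6, 7, 2, 4, 3;
     0, 2, 6, 5, 1, 4]

/-- The real matrix `H`. -/
noncomputable def matH : Matrix (Fin 6) (Fin 6) ℝ :=
  Matrix.of fun i j => (matK i j : ℝ) / 8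

def matA : Matrix (Fin 3) (Fin 6) ℤ :=
  !![0, 2, 4, 1, 5, 6;
     0, 6, 3, 4, 2, 7;
     0, 6, 7, 2, 4, 3]

def matL : Matrix (Fin 6) (Fin 3) ℤ :=
  !![0, 0, 0;
     0, 1, 1;
     1, 0, 0;
     0, 1, 0;
     0, 0, 1;
     7, 1, 1]

/-- The set of columns of `A` in `(ℤ/8)³`. -/
def setA : Set (Fin 3 → ZMod 8) :=
  Set.range fun j : Fin 6 => fun i : Fin 3 => (matA i j : ZMod 8)

/-- The character `x ↦ e^{2π i ⟨l, x⟩ / 8}` of `(ℤ/8)³`. -/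
noncomputable def rowChar (l : Fin 3 → ZMod 8) : AddChar (Fin 3 → ZMod 8) Circle :=
  (ZMod.toCircle (N := 8)).compAddMonoidHom
    (AddMonoidHom.mk' (fun x => l ⬝ᵥ x) (fun x y => dotProduct_add l x y))

/-- The set of characters of `(ℤ/8)³` given by the rows of `L`. -/
def specL : Set (AddChar (Fin 3 → ZMod 8) Circle) :=
  Set.range fun m : Fin 6 => rowChar fun i : Fin 3 => (matL m i : ZMod 8)

/-- `A_n = A + 8[0,n)³ ⊆ ℤ³`, with the columns of `A` taken as integer vectors. -/
def setAn (n : ℕ) : Set (Fin 3 → ℤ) :=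
  {x | ∃ (j : Fin 6) (k : Fin 3 → ℤ),
    (∀ i, k i ∈ Set.Ico (0 : ℤ) n) ∧ x = fun i => matA i j + 8 * k i}

/-- The union of cubes `S + [0,1)³ ⊆ ℝ³` for `S ⊆ ℤ³`. -/
def cubes (S : Set (Fin 3 → ℤ)) : Set (Fin 3 → ℝ) :=
  {x | ∃ a ∈ S, ∃ u : Fin 3 → ℝ, (∀ i, u i ∈ Set.Ico (0 : ℝ) 1) ∧ x = fun i => (a i : ℝ) + u i}

/-!
The matrix `8H` has the property that the entries of the difference of two distinct rows, read in
`ℤ/8`, split into antipodal pairs `{r, r + 4}`; hence the eighth roots of unity that they stand for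
cancel, and `H` is log-Hadamard. As `8H ≡ LA (mod 8)`, its entries are the values of six characters
(the rows of `L`) at six points (the columns of `A`).

*Spectrality.* A finite set of points together with equally many characters whose value matrix is a
complex Hadamard matrix is a spectral pair: invertibility of the matrix gives completeness
(`isSpectrum_count`). This applies to `A ⊆ (ℤ/8)³` directly, and to `A_n ⊆ ℤ³` with the frequencies
`l / 8 + r / (8n)`, where `l` is a row of `L` and `r ∈ [0, n)³`: the sum over `A_n` factors through
complete sums of `n`-th roots of unity, which force `r = r'`, and then the matrix `H` takes over
(`isHadamard_An`). Passing from a finite `S ⊆ ℤ³` to `S + [0,1)³` adds all of `ℤ³` to the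
frequencies. Completeness (`isSpectrum_cubes`) follows by folding a function orthogonal to all the
characters onto the unit cube: each folded function has vanishing Fourier coefficients, hence
vanishes, and inverting the Hadamard matrix recovers the original function on each cube.

*Failure of tiling.* In `(ℤ/8)³` the order `512` is not a multiple of `6`. In `ℝ³`, the set
`A_n + [0,1)³` is `8ℤ³`-periodic inside `[0, 8n)³` and has volume `6` in every window of side `8`
contained in that cube (`volume_cubes_inter_box`). If it tiled, a packing bound independent of `n`
would limit the number of translates near `[0, 8n)³`, so for large `n` some window of side `8` would
avoid the boundary of every translated cube (`exists_mem_Ico_avoiding`). Each translate would meet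
this window in volume `0` or `6`, while the total volume is `512`, which is impossible
(`not_tiles_of_ae_eq_cubes`). A tiling of `ℤ³` by `A_n` would give one of `ℝ³` (`Tiles.cubes`), and
replacing the half-open cubes by open ones changes `A_n + [0,1)³` only by a null set.
-/

/-! ### Spectra from complex Hadamard matrices -/

/-- Density of the span may be checked on the orthogonal complement: it suffices that a
square-integrable function orthogonal to all the characters vanishes almost everywhere. -/
theorem IsSpectrum.of_complete {G : Type*} [AddCommGroup G] [TopologicalSpace G]
    [MeasurableSpace G] {μ : Measure G} {Ω : Set G} {Λ : Set (AddChar G Circle)}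
    (hcont : ∀ χ ∈ Λ, Continuous (fun x => χ x))
    (hmem : ∀ χ ∈ Λ, MemLp (fun x => (χ x : ℂ)) 2 (μ.restrict Ω))
    (horth : ∀ χ ∈ Λ, ∀ ψ ∈ Λ, χ ≠ ψ → ∫ x in Ω, (χ x : ℂ) * conj (ψ x : ℂ) ∂μ = 0)
    (hcomp : ∀ f : G → ℂ, MemLp f 2 (μ.restrict Ω) →
      (∀ χ ∈ Λ, ∫ x in Ω, conj (χ x : ℂ) * f x ∂μ = 0) → f =ᵐ[μ.restrict Ω] 0) :
    IsSpectrum μ Ω Λ where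
  continuous_char := hcont
  memLp := hmem
  orthogonal := horth
  dense_span := by
    rw [Submodule.topologicalClosure_eq_top_iff, Submodule.eq_bot_iff]
    intro f hf
    rw [Submodule.mem_orthogonal] at hf
    rw [Lp.eq_zero_iff_ae_eq_zero]
    refine hcomp f (Lp.memLp f) fun χ hχ => ?_
    have h := hf ((hmem χ hχ).toLp _) (Submodule.subset_span ⟨χ, hχ, (hmem χ hχ).coeFn_toLp⟩)
    rw [L2.inner_def] at h
    rw [← h]
    refine integral_congr_ae ?_
    filter_upwards [(hmem χ hχ).coeFn_toLp] with x hx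
    rw [hx, RCLike.inner_apply, mul_comm]

theorem memLp_circle_of_measure_ne_top {G : Type*} [MeasurableSpace G] {μ : Measure G} {Ω : Set G}
    {χ : G → Circle} (hΩ : μ Ω ≠ ∞)
    (hχ : AEStronglyMeasurable (fun x => (χ x : ℂ)) (μ.restrict Ω)) :
    MemLp (fun x => (χ x : ℂ)) 2 (μ.restrict Ω) := by
  have : IsFiniteMeasure (μ.restrict Ω) := isFiniteMeasure_restrict.2 hΩ
  exact MemLp.of_bound hχ 1 (Filter.Eventually.of_forall fun x => (Circle.norm_coe (χ x)).le)

/-- A complex Hadamard matrix is invertible; this is how completeness of a system of characters is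
deduced from the number of points. -/
theorem eq_zero_of_isHadamard {ι : Type*} [Fintype ι] [DecidableEq ι] {M : Matrix ι ι ℂ}
    (hM : M.IsHadamard) {v : ι → ℂ} (hv : ∀ i, ∑ s, conj (M i s) * v s = 0) : v = 0 := by
  have h1 := hM.transpose.mul_conjTranspose
  have h2 : M.transpose.conjTranspose *ᵥ v = 0 := by
    ext i; simpa [mulVec, dotProduct] using hv i
  have h3 : (M.transpose * M.transpose.conjTranspose) *ᵥ v = 0 := by
    rw [← mulVec_mulVec, h2, mulVec_zero]
  rw [h1, smul_mulVec, one_mulVec] at h3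
  ext i
  have : Nonempty ι := ⟨i⟩
  have h4 := congrFun h3 i
  simpa using h4

theorem isHadamard_of_circle {ι : Type*} [Fintype ι] [DecidableEq ι] (χ : ι → ι → Circle)
    (h : ∀ i j, i ≠ j → ∑ s, ((χ i s / χ j s : Circle) : ℂ) = 0) :
    (Matrix.of fun i s => (χ i s : ℂ)).IsHadamard := by
  rcases isEmpty_or_nonempty ι with hι | hι
  · exact ⟨fun i => isEmptyElim i, by ext i; exact isEmptyElim i, by ext i; exact isEmptyElim i⟩
  refine Matrix.IsHadamard.of_mul_conjTranspose (fun i j => ?_) ?_ ?_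
  · have h1 := Circle.normSq_coe (χ i j)
    rw [Matrix.of_apply, Unitary.mem_iff_star_mul_self, Complex.star_def,
      ← Complex.normSq_eq_conj_mul_self, h1, Complex.ofReal_one]
  · ext i j
    rw [Matrix.mul_apply]
    rcases eq_or_ne i j with rfl | hij
    · simp [Complex.mul_conj]
    · simpa [hij, Circle.coe_div, div_eq_mul_inv, ← Circle.coe_inv_eq_conj] using h i j hij
  · exact IsRegular.of_ne_zero (by simp)

theorem sum_mul_conj_eq_zero_of_isHadamard {ι : Type*} [Fintype ι] [DecidableEq ι]
    {χ : ι → ι → Circle}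
    (h : (Matrix.of fun i s => (χ i s : ℂ)).IsHadamard) {i j : ι} (hij : i ≠ j) :
    ∑ s, (χ i s : ℂ) * conj (χ j s : ℂ) = 0 := by
  have := congrFun (congrFun h.mul_conjTranspose i) j
  simpa [Matrix.mul_apply, hij] using this

theorem setIntegral_count_range {ι G : Type*} [Fintype ι] [MeasurableSpace G]
    [MeasurableSingletonClass G] {p : ι → G} (hp : Function.Injective p) (f : G → ℂ) :
    ∫ x in Set.range p, f x ∂Measure.count = ∑ s, f (p s) := by
  classical
  have h : Set.range p = ((Finset.univ.map ⟨p, hp⟩ : Finset G) : Set G) := by ext; simp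
  rw [h, setIntegral_finset]
  · simp [Measure.real]
  · rw [← Set.biUnion_of_singleton (Finset.univ.map ⟨p, hp⟩ : Set G)]
    exact integrableOn_finset_iUnion.2 fun x _ =>
      integrableOn_singleton (hx := by simp)

/-- A finite set of points in a discrete group and equally many characters form a spectral pair as
soon as the matrix of values is a complex Hadamard matrix. -/
theorem isSpectrum_count {ι G : Type*} [Fintype ι] [DecidableEq ι] [AddCommGroup G]
    [TopologicalSpace G] [DiscreteTopology G] [MeasurableSpace G] [MeasurableSingletonClass G]
    [Countable G]
    {p : ι → G} (hp : Function.Injective p) {χ : ι → AddChar G Circle}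
    (hχ : (Matrix.of fun i s => (χ i (p s) : ℂ)).IsHadamard) :
    IsSpectrum Measure.count (Set.range p) (Set.range χ) := by
  have hfin : Measure.count (Set.range p) ≠ ∞ := by
    rw [← lt_top_iff_ne_top, Measure.count_apply_lt_top]; exact Set.finite_range p
  refine IsSpectrum.of_complete (fun _ _ => continuous_of_discreteTopology) ?_ ?_ ?_
  · rintro _ ⟨i, rfl⟩
    exact memLp_circle_of_measure_ne_top hfin (measurable_of_countable _).aestronglyMeasurable
  · rintro _ ⟨i, rfl⟩ _ ⟨j, rfl⟩ hij
    rw [setIntegral_count_range hp]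
    exact sum_mul_conj_eq_zero_of_isHadamard (χ := fun i s => χ i (p s)) hχ
      (fun h => hij (by rw [h]))
  · intro f _ hf
    have h0 : (fun s => f (p s)) = 0 := eq_zero_of_isHadamard hχ fun i => by
      have := hf _ ⟨i, rfl⟩
      rwa [setIntegral_count_range hp] at this
    have hr : MeasurableSet (Set.range p) := (Set.finite_range p).measurableSet
    rw [Filter.EventuallyEq, ae_restrict_iff' hr]
    refine Filter.Eventually.of_forall ?_
    rintro _ ⟨s, rfl⟩
    exact congrFun h0 s

/-! ### The matrix `H` and the six-element set in `(ℤ/8)³` -/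

theorem ZMod.toCircle_add_four (r : ZMod 8) :
    (ZMod.toCircle (r + 4) : ℂ) = - (ZMod.toCircle r : ℂ) := by
  have h4 : (ZMod.toCircle (4 : ZMod 8) : ℂ) = -1 := by
    have := ZMod.toCircle_intCast (N := 8) 4
    push_cast at this
    rw [this, ← Complex.exp_pi_mul_I]
    congr 1
    ring
  rw [AddChar.map_add_eq_mul, Circle.coe_mul, h4, mul_neg_one]

/-- The difference of two distinct rows of `8H` is, as a multiset in `ℤ/8`, invariant under the
antipodal map `r ↦ r + 4`. -/
theorem matK_sub_antipodal : ∀ i j : Fin 6, i ≠ j →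
    Finset.univ.val.map (fun s => ((matK i s - matK j s : ℤ) : ZMod 8)) =
    Finset.univ.val.map (fun s => ((matK i s - matK j s : ℤ) : ZMod 8) + 4) := by
  decide

theorem sum_toCircle_matK {i j : Fin 6} (hij : i ≠ j) :
    ∑ s, (ZMod.toCircle ((matK i s - matK j s : ℤ) : ZMod 8) : ℂ) = 0 := by
  have h := congrArg (fun m => (m.map fun r : ZMod 8 => (ZMod.toCircle r : ℂ)).sum)
    (matK_sub_antipodal i j hij)
  simp only [Multiset.map_map, Function.comp_def, ZMod.toCircle_add_four] at h
  change ∑ s, _ = ∑ s, _ at h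
  rw [Finset.sum_neg_distrib] at h
  exact self_eq_neg.1 h

theorem isHadamard_toCircle :
    (Matrix.of fun i s => (ZMod.toCircle (matK i s : ZMod 8) : ℂ)).IsHadamard :=
  isHadamard_of_circle (fun i s => ZMod.toCircle (matK i s : ZMod 8)) fun i j hij => by
    simpa [AddChar.map_sub_eq_div] using sum_toCircle_matK hij

theorem toCircle_matK (i s : Fin 6) : (ZMod.toCircle (matK i s : ZMod 8) : ℂ) =
    Complex.exp (2 * (Real.pi : ℂ) * Complex.I * (matH i s : ℂ)) := by
  rw [ZMod.toCircle_intCast]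
  congr 1
  simp [matH]
  ring

theorem isLogHadamard_matH : IsLogHadamard matH := by
  have h := isHadamard_toCircle
  simp only [toCircle_matK] at h
  exact h

theorem matK_eq_matL_mul_matA (i j : Fin 6) : ∃ z : ℤ, matK i j = (matL * matA) i j + 8 * z := by
  have : ∀ i j : Fin 6, (8 : ℤ) ∣ matK i j - (matL * matA) i j := by decide
  obtain ⟨z, hz⟩ := this i j
  exact ⟨z, by omega⟩

theorem eight_mul_matH (i j : Fin 6) :
    ∃ z : ℤ, (8 : ℝ) * matH i j = (((matL * matA) i j : ℤ) : ℝ) + 8 * (z : ℝ) := by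
  obtain ⟨z, hz⟩ := matK_eq_matL_mul_matA i j
  refine ⟨z, ?_⟩
  have : (8 : ℝ) * matH i j = (matK i j : ℝ) := by simp [matH]; ring
  rw [this, hz]; push_cast; ring

/-- The `j`-th column of `A` modulo `8`. -/
def colA (j : Fin 6) : Fin 3 → ZMod 8 := fun i => (matA i j : ZMod 8)

theorem colA_injective : Function.Injective colA := by
  have : ∀ i j : Fin 6, colA i = colA j → i = j := by decide
  exact fun i j => this i j

theorem rowL_injective :
    Function.Injective fun (m : Fin 6) (i : Fin 3) => (matL m i : ZMod 8) := by
  have : ∀ i j : Fin 6, (fun k : Fin 3 => (matL i k : ZMod 8)) = (fun k => (matL j k : ZMod 8)) →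
    i = j := by decide
  exact fun i j => this i j

theorem rowChar_apply (l x : Fin 3 → ZMod 8) : rowChar l x = ZMod.toCircle (l ⬝ᵥ x) := rfl

theorem rowChar_injective : Function.Injective rowChar := by
  intro l l' h
  ext i
  have := DFunLike.congr_fun h (Pi.single i 1)
  rw [rowChar_apply, rowChar_apply] at this
  simpa using ZMod.injective_toCircle this

theorem ncard_setA : setA.ncard = 6 := by
  have h := Set.ncard_range_of_injective colA_injective
  rw [Nat.card_fin] at h
  exact h

theorem ncard_specL : specL.ncard = 6 := by
  have h := Set.ncard_range_of_injective (rowChar_injective.comp rowL_injective)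
  rw [Nat.card_fin] at h
  exact h

theorem card_zmod_eight_cubed : Nat.card (Fin 3 → ZMod 8) = 512 := by
  simp

theorem isSpectrum_setA : IsSpectrum Measure.count setA specL := by
  refine isSpectrum_count (p := colA) colA_injective
    (χ := fun m : Fin 6 => rowChar fun i : Fin 3 => (matL m i : ZMod 8)) ?_
  convert isHadamard_toCircle using 6 with i s
  obtain ⟨z, hz⟩ := matK_eq_matL_mul_matA i s
  rw [rowChar_apply, hz]
  congr 1
  have : (8 : ZMod 8) = 0 := rfl
  simp [Matrix.mul_apply, dotProduct, colA, this]
  rfl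

theorem not_tiles_count_of_not_dvd {G : Type*} [AddCommGroup G] [Finite G] [MeasurableSpace G]
    [MeasurableSingletonClass G] {Ω : Set G} (h : ¬ Ω.ncard ∣ Nat.card G) :
    ¬ Tiles Measure.count Ω := by
  classical
  rintro ⟨T, hT⟩
  have := Fintype.ofFinite G
  rw [Measure.ae_count_iff] at hT
  have h1 : ∑ x : G, ∑ t : T, Ω.indicator (fun _ => (1 : ℝ≥0∞)) (x - (t : G)) =
      Nat.card G := by
    simp_rw [← tsum_fintype (L := .unconditional T), hT]
    simp
  rw [Finset.sum_comm] at h1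
  have h2 : ∀ t : T, ∑ x : G, Ω.indicator (fun _ => (1 : ℝ≥0∞)) (x - (t : G)) = Ω.ncard := by
    intro t
    refine ((Equiv.subRight (t : G)).sum_comp (Ω.indicator fun _ => (1 : ℝ≥0∞))).trans ?_
    simp [Set.indicator_apply, Set.ncard_eq_toFinset_card']
  simp only [h2, Finset.sum_const, nsmul_eq_mul] at h1
  exact h ⟨_, by rw [mul_comm]; exact_mod_cast h1.symm⟩

theorem not_tiles_setA : ¬ Tiles Measure.count setA :=
  not_tiles_count_of_not_dvd (by rw [ncard_setA, card_zmod_eight_cubed]; norm_num)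

/-! ### Characters of `ℝᵈ` and `ℤᵈ`, and the sets `A_n` -/

/-- The character `x ↦ e^{2π i ⟨θ, x⟩}` of `ℝᵈ`. -/
noncomputable def euclChar {d : Type*} [Fintype d] (θ : d → ℝ) : AddChar (d → ℝ) Circle :=
  Real.fourierChar.compAddMonoidHom
    (AddMonoidHom.mk' (fun x => θ ⬝ᵥ x) (fun x y => dotProduct_add θ x y))

theorem euclChar_apply {d : Type*} [Fintype d] (θ x : d → ℝ) :
    euclChar θ x = Real.fourierChar (θ ⬝ᵥ x) := rfl

theorem euclChar_add {d : Type*} [Fintype d] (θ η x : d → ℝ) :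
    euclChar (θ + η) x = euclChar θ x * euclChar η x := by
  simp [euclChar_apply, add_dotProduct, AddChar.map_add_eq_mul]

/-- The embedding `ℤᵈ → ℝᵈ`. -/
def latticeEmb (d : Type*) : (d → ℤ) →+ (d → ℝ) where
  toFun x i := x i
  map_zero' := by ext; simp
  map_add' x y := by ext; simp

theorem latticeEmb_apply {d : Type*} (x : d → ℤ) (i : d) : latticeEmb d x i = x i := rfl

/-- The restriction to `ℤᵈ` of the character of `ℝᵈ` with frequency `θ`. -/
noncomputable def latticeChar {d : Type*} [Fintype d] (θ : d → ℝ) : AddChar (d → ℤ) Circle :=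
  (euclChar θ).compAddMonoidHom (latticeEmb d)

theorem latticeChar_apply {d : Type*} [Fintype d] (θ : d → ℝ) (x : d → ℤ) :
    latticeChar θ x = euclChar θ (latticeEmb d x) := rfl

theorem fourierChar_intCast (z : ℤ) : Real.fourierChar (z : ℝ) = 1 := by
  apply Circle.ext
  rw [Real.fourierChar_apply, Circle.coe_one, Complex.exp_eq_one_iff]
  exact ⟨z, by push_cast; ring⟩

theorem euclChar_latticeEmb {d : Type*} [Fintype d] (z x : d → ℤ) :
    euclChar (latticeEmb d z) (latticeEmb d x) = 1 := by
  rw [euclChar_apply, ← fourierChar_intCast (z ⬝ᵥ x)]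
  simp [dotProduct, latticeEmb_apply]

theorem fourierChar_div_eight (z : ℤ) :
    Real.fourierChar ((z : ℝ) / 8) = ZMod.toCircle (z : ZMod 8) := by
  apply Circle.ext
  rw [Real.fourierChar_apply, ZMod.toCircle_intCast]
  congr 1
  push_cast
  ring

theorem map_sum_fourierChar {d : Type*} [Fintype d] (f : d → ℝ) :
    Real.fourierChar (∑ i, f i) = ∏ i, Real.fourierChar (f i) :=
  map_prod Real.fourierChar.toMonoidHom (fun i => Multiplicative.ofAdd (f i)) Finset.univ

theorem coe_circle_prod {d : Type*} [Fintype d] (f : d → Circle) :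
    ((∏ i, f i : Circle) : ℂ) = ∏ i, (f i : ℂ) :=
  map_prod Circle.coeHom f Finset.univ

theorem sum_fourierChar_div {n : ℕ} {a b : Fin n} (hab : a ≠ b) :
    ∑ k : Fin n, (Real.fourierChar (((a : ℝ) - b) / n * (k : ℕ)) : ℂ) = 0 := by
  have hn : (n : ℝ) ≠ 0 := by have := a.pos; positivity
  have hz : Real.fourierChar (((a : ℝ) - b) / n) ≠ 1 := by
    intro h
    have h1 := congrArg (fun z : Circle => (z : ℂ)) h
    simp only [Real.fourierChar_apply, Circle.coe_one] at h1
    obtain ⟨m, hm⟩ := Complex.exp_eq_one_iff.1 h1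
    have h2 : (((a : ℝ) - b) / n : ℝ) = m := by
      have h3 : (2 * Real.pi * Complex.I : ℂ) ≠ 0 := by simp [Real.pi_ne_zero]
      have h4 : ((((a : ℝ) - b) / n : ℝ) : ℂ) = (m : ℂ) := by
        apply mul_right_cancel₀ h3
        rw [← hm]; push_cast; ring
      exact_mod_cast h4
    rw [div_eq_iff hn] at h2
    have h5 : (a : ℤ) - b = m * n := by exact_mod_cast h2
    have h6 := Int.eq_zero_of_abs_lt_dvd (m := n) (x := (a : ℤ) - b) ⟨m, by rw [h5]; ring⟩
      (by rw [abs_lt]; omega)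
    exact hab (Fin.ext (by omega))
  have h1 : ∀ k : ℕ, (Real.fourierChar (((a : ℝ) - b) / n * k) : ℂ) =
      (Real.fourierChar (((a : ℝ) - b) / n) : ℂ) ^ k := fun k => by
    rw [mul_comm, ← nsmul_eq_mul, AddChar.map_nsmul_eq_pow, Circle.coe_pow]
  simp_rw [h1]
  rw [Fin.sum_univ_eq_sum_range (fun k => (Real.fourierChar (((a : ℝ) - b) / n) : ℂ) ^ k),
    geom_sum_eq (fun h => hz (Circle.ext h)), ← h1, div_mul_cancel₀ _ hn]
  have := fourierChar_intCast ((a : ℤ) - b)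
  push_cast at this
  simp [this]

/-- The points of `A_n`, indexed by a column of `A` and a vector in `[0, n)³`. -/
def pointAn (n : ℕ) (q : Fin 6 × (Fin 3 → Fin n)) : Fin 3 → ℤ :=
  fun i => matA i q.1 + 8 * (q.2 i : ℕ)

/-- The frequencies of the spectrum of `A_n`: the rows of `L` divided by `8`, refined by the vectors
`r / (8n)` with `r ∈ [0, n)³`. -/
noncomputable def freqAn (n : ℕ) (q : Fin 6 × (Fin 3 → Fin n)) : Fin 3 → ℝ :=
  fun i => (matL q.1 i : ℝ) / 8 + ((q.2 i : ℕ) : ℝ) / (8 * n)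

theorem matA_mem (i : Fin 3) (j : Fin 6) : 0 ≤ matA i j ∧ matA i j < 8 := by
  fin_cases i <;> fin_cases j <;> simp [matA]

theorem pointAn_injective (n : ℕ) : Function.Injective (pointAn n) := by
  rintro ⟨j, k⟩ ⟨j', k'⟩ h
  have h1 : ∀ i, matA i j = matA i j' ∧ (k i : ℕ) = k' i := fun i => by
    have := congrFun h i
    simp only [pointAn] at this
    have := matA_mem i j
    have := matA_mem i j'
    omega
  have h2 : j = j' := colA_injective (funext fun i => by simp only [colA, (h1 i).1])
  exact Prod.ext h2 (funext fun i => Fin.ext (h1 i).2)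

theorem range_pointAn (n : ℕ) : Set.range (pointAn n) = setAn n := by
  ext x
  constructor
  · rintro ⟨⟨j, k⟩, rfl⟩
    exact ⟨j, fun i => (k i : ℕ), fun i => ⟨by positivity, Int.ofNat_lt.2 (k i).2⟩, rfl⟩
  · rintro ⟨j, k, hk, rfl⟩
    refine ⟨⟨j, fun i => ⟨(k i).toNat, ?_⟩⟩, ?_⟩
    · have := hk i; simp only [Set.mem_Ico] at this; omega
    · ext i
      have := hk i
      simp only [Set.mem_Ico] at this
      simp [pointAn, this.1]

/-- The frequencies `freqAn` and the points `pointAn` form a complex Hadamard matrix. -/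
theorem isHadamard_An (n : ℕ) :
    (Matrix.of fun q s => (latticeChar (freqAn n q) (pointAn n s) : ℂ)).IsHadamard := by
  refine isHadamard_of_circle (fun q s => latticeChar (freqAn n q) (pointAn n s)) ?_
  rintro ⟨m, r⟩ ⟨m', r'⟩ hne
  rcases Nat.eq_zero_or_pos n with rfl | hn
  · exact (r 0).elim0
  have hn' : (n : ℝ) ≠ 0 := by positivity
  -- The rows of `L` contribute integer phases on the `8ℤ³`-part of a point, so that part only sees
  -- the difference of `r` and `r'`.
  have key : ∀ (j : Fin 6) (k : Fin 3 → Fin n),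
      latticeChar (freqAn n (m, r)) (pointAn n (j, k)) /
        latticeChar (freqAn n (m', r')) (pointAn n (j, k)) =
      Real.fourierChar (∑ i, (((matL m i : ℝ) - matL m' i) / 8 +
        ((r i : ℕ) - (r' i : ℕ) : ℝ) / (8 * n)) * matA i j) *
      ∏ i, Real.fourierChar (((r i : ℕ) - (r' i : ℕ) : ℝ) / n * (k i : ℕ)) := by
    intro j k
    rw [latticeChar_apply, latticeChar_apply, euclChar_apply, euclChar_apply,
      ← AddChar.map_sub_eq_div, ← map_sum_fourierChar, ← AddChar.map_add_eq_mul,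
      ← mul_one (Real.fourierChar (_ + _)),
      ← fourierChar_intCast (∑ i, (matL m i - matL m' i) * (k i : ℕ)), ← AddChar.map_add_eq_mul]
    congr 1
    push_cast
    simp only [dotProduct, freqAn, pointAn, latticeEmb_apply, ← Finset.sum_sub_distrib,
      ← Finset.sum_add_distrib]
    refine Finset.sum_congr rfl fun i _ => ?_
    push_cast
    field_simp
    ring
  simp_rw [key, Fintype.sum_prod_type, Circle.coe_mul, ← Finset.mul_sum]
  by_cases hr : r = r'
  · subst hr
    have hm : m ≠ m' := fun h => hne (by rw [h])
    have h1 : ∀ j : Fin 6, Real.fourierChar (∑ i, (((matL m i : ℝ) - matL m' i) / 8 +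
        ((r i : ℕ) - (r i : ℕ) : ℝ) / (8 * n)) * matA i j) =
        ZMod.toCircle ((matK m j - matK m' j : ℤ) : ZMod 8) := by
      intro j
      obtain ⟨z, hz⟩ := matK_eq_matL_mul_matA m j
      obtain ⟨z', hz'⟩ := matK_eq_matL_mul_matA m' j
      rw [← fourierChar_div_eight, hz, hz', ← mul_one (Real.fourierChar (∑ i, _)),
        ← fourierChar_intCast (z - z'), ← AddChar.map_add_eq_mul]
      congr 1
      simp only [sub_self, zero_div, add_zero, Matrix.mul_apply, Fin.sum_univ_three]
      push_cast
      ring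
    simp_rw [h1, ← Finset.sum_mul]
    rw [sum_toCircle_matK hm, zero_mul]
  · obtain ⟨i, hi⟩ := Function.ne_iff.1 hr
    refine Finset.sum_eq_zero fun j _ => mul_eq_zero_of_right _ ?_
    simp only [coe_circle_prod]
    rw [← Fintype.piFinset_univ]
    refine (Finset.prod_univ_sum (fun _ => Finset.univ) (fun (i : Fin 3) (a : Fin n) =>
      (Real.fourierChar (((r i : ℕ) - (r' i : ℕ) : ℝ) / n * (a : ℕ)) : ℂ))).symm.trans ?_
    exact Finset.prod_eq_zero (Finset.mem_univ i) (sum_fourierChar_div hi)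

theorem isSpectral_setAn (n : ℕ) : IsSpectral Measure.count (setAn n) := by
  rw [← range_pointAn]
  exact ⟨_, isSpectrum_count (pointAn_injective n) (isHadamard_An n)⟩

/-! ### Completeness of the characters of `ℤᵈ` on the unit cube -/

section torus

-- Fourier series on the torus are developed for the Haar probability measure on `ℝ / ℤ`.
noncomputable local instance : MeasureSpace UnitAddCircle := ⟨AddCircle.haarAddCircle⟩

theorem mFourier_coe {d : Type*} [Fintype d] (z : d → ℤ) (x : d → ℝ) :
    UnitAddTorus.mFourier (-z) (fun i => (x i : UnitAddCircle)) =
      conj (euclChar (latticeEmb d z) x : ℂ) := by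
  rw [UnitAddTorus.mFourier_neg, euclChar_apply, dotProduct, map_sum_fourierChar, coe_circle_prod]
  congr 1
  refine Finset.prod_congr rfl fun i _ => ?_
  rw [fourier_coe_apply, Real.fourierChar_apply, latticeEmb_apply]
  congr 1
  push_cast
  ring

/-- The cube `(0,1]ᵈ` is a measure-preserving copy of the torus, where the Fourier basis is
complete. -/
theorem ae_eq_zero_of_fourier_Ioc {d : Type*} [Fintype d] {g : (d → ℝ) → ℂ}
    (hg : MemLp g 2 (volume.restrict {x : d → ℝ | ∀ i, x i ∈ Set.Ioc (0 : ℝ) (0 + 1)}))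
    (h : ∀ z : d → ℤ, ∫ x in {x : d → ℝ | ∀ i, x i ∈ Set.Ioc (0 : ℝ) (0 + 1)},
      conj (euclChar (latticeEmb d z) x : ℂ) * g x = 0) :
    g =ᵐ[volume.restrict {x : d → ℝ | ∀ i, x i ∈ Set.Ioc (0 : ℝ) (0 + 1)}] 0 := by
  have hQ : MeasurableSet {x : d → ℝ | ∀ i, x i ∈ Set.Ioc (0 : ℝ) (0 + 1)} :=
    MeasurableSet.univ_pi' fun i => measurableSet_Ioc
  have hmp := UnitAddTorus.measurePreserving_equivPiIoc (fun _ : d => (0 : ℝ))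
  have hmp2 : MeasurePreserving
      (Subtype.val : {x : d → ℝ // ∀ i, x i ∈ Set.Ioc (0 : ℝ) (0 + 1)} → _)
      (Measure.comap Subtype.val volume)
      (volume.restrict {x : d → ℝ | ∀ i, x i ∈ Set.Ioc (0 : ℝ) (0 + 1)}) :=
    ⟨measurable_subtype_coe, map_comap_subtype_coe hQ _⟩
  have hmp3 := hmp2.comp hmp
  set φ : UnitAddTorus d → (d → ℝ) :=
    Subtype.val ∘ UnitAddTorus.measurableEquivPiIoc (fun _ : d => (0 : ℝ)) with hφ
  have hφ' : ∀ x : d → ℝ, (∀ i, x i ∈ Set.Ioc (0 : ℝ) (0 + 1)) →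
      φ (fun i => (x i : UnitAddCircle)) = x := by
    intro x hx
    have := (UnitAddTorus.measurableEquivPiIoc (fun _ : d => (0 : ℝ))).apply_symm_apply ⟨x, hx⟩
    exact congrArg Subtype.val this
  have hmem : MemLp (g ∘ φ) 2 volume := hg.comp_measurePreserving hmp3
  have hcoef : ∀ z, UnitAddTorus.mFourierCoeff (hmem.toLp _) z = 0 := by
    intro z
    have h1 : UnitAddTorus.mFourierCoeff (hmem.toLp _) z =
        UnitAddTorus.mFourierCoeff (g ∘ φ) z := by
      refine integral_congr_ae ?_
      filter_upwards [hmem.coeFn_toLp] with x hx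
      rw [hx]
    rw [h1, UnitAddTorus.mFourierCoeff_eq_integral _ _ (fun _ => 0), ← h z]
    refine setIntegral_congr_fun hQ fun x hx => ?_
    simp only [Function.comp_apply, hφ' x hx, mFourier_coe, smul_eq_mul]
  have hzero : hmem.toLp _ = 0 := by
    have := UnitAddTorus.hasSum_mFourier_series_L2 (hmem.toLp _)
    simp only [hcoef, zero_smul] at this
    exact this.unique hasSum_zero
  have hae : g ∘ φ =ᵐ[volume] 0 :=
    hmem.coeFn_toLp.symm.trans (by rw [hzero]; exact Lp.coeFn_zero _ _ _)
  rw [← hmp3.map_eq]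
  have hemb : MeasurableEmbedding φ :=
    (MeasurableEmbedding.subtype_coe hQ).comp (MeasurableEquiv.measurableEmbedding _)
  exact hemb.ae_map_iff.2 hae

end torus

/-- The half-open unit cube `[0, 1)ᵈ`. -/
def unitCube (d : Type*) : Set (d → ℝ) := Set.univ.pi fun _ => Set.Ico (0 : ℝ) 1

theorem measurableSet_unitCube (d : Type*) [Countable d] : MeasurableSet (unitCube d) :=
  MeasurableSet.univ_pi fun _ => measurableSet_Ico

theorem volume_unitCube (d : Type*) [Fintype d] : volume (unitCube d) = 1 := by
  simp [unitCube, volume_pi_pi]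

/-- A square-integrable function on the unit cube with vanishing Fourier coefficients vanishes
almost everywhere. -/
theorem ae_eq_zero_of_fourier {d : Type*} [Fintype d] {g : (d → ℝ) → ℂ}
    (hg : MemLp g 2 (volume.restrict (unitCube d)))
    (h : ∀ z : d → ℤ, ∫ x in unitCube d, conj (euclChar (latticeEmb d z) x : ℂ) * g x = 0) :
    g =ᵐ[volume.restrict (unitCube d)] 0 := by
  have hQ : volume.restrict (unitCube d) =
      volume.restrict {x : d → ℝ | ∀ i, x i ∈ Set.Ioc (0 : ℝ) (0 + 1)} := by
    refine Measure.restrict_congr_set ?_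
    have h1 : unitCube d =ᵐ[volume] Set.Icc (0 : d → ℝ) 1 := Measure.univ_pi_Ico_ae_eq_Icc
    have h2 : (Set.univ.pi fun _ : d => Set.Ioc (0 : ℝ) 1) =ᵐ[volume] Set.Icc (0 : d → ℝ) 1 :=
      Measure.univ_pi_Ioc_ae_eq_Icc
    have h3 : {x : d → ℝ | ∀ i, x i ∈ Set.Ioc (0 : ℝ) (0 + 1)} =
        Set.univ.pi fun _ : d => Set.Ioc (0 : ℝ) 1 := by
      ext x; simp
    rw [h3]
    exact h1.trans h2.symm
  rw [hQ] at hg ⊢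
  simp_rw [hQ] at h
  exact ae_eq_zero_of_fourier_Ioc hg h

/-! ### Unions of unit cubes -/

theorem continuous_euclChar {d : Type*} [Fintype d] (θ : d → ℝ) :
    Continuous (fun x => euclChar θ x) :=
  Real.continuous_fourierChar.comp (Continuous.dotProduct continuous_const continuous_id)

theorem euclChar_sub {d : Type*} [Fintype d] (θ η x : d → ℝ) :
    euclChar (θ - η) x = euclChar θ x / euclChar η x := by
  simp [euclChar_apply, sub_dotProduct, AddChar.map_sub_eq_div]

theorem setIntegral_Ico_fourierChar {m : ℤ} (hm : m ≠ 0) :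
    ∫ t in Set.Ico (0 : ℝ) 1, (Real.fourierChar (m * t) : ℂ) = 0 := by
  have hc : (2 * Real.pi * m * Complex.I : ℂ) ≠ 0 := by
    simp [Real.pi_ne_zero, hm]
  have h1 : ∀ t : ℝ, (Real.fourierChar (m * t) : ℂ) =
      Complex.exp (2 * Real.pi * m * Complex.I * t) := fun t => by
    rw [Real.fourierChar_apply]; congr 1; push_cast; ring
  have h2 : Complex.exp (2 * Real.pi * m * Complex.I) = 1 :=
    Complex.exp_eq_one_iff.2 ⟨m, by ring⟩
  rw [integral_Ico_eq_integral_Ioc, ← intervalIntegral.integral_of_le zero_le_one]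
  simp_rw [h1]
  rw [integral_exp_mul_complex hc]
  simp [h2]

theorem setIntegral_unitCube_euclChar {d : Type*} [Fintype d] {z : d → ℤ} (hz : z ≠ 0) :
    ∫ u in unitCube d, (euclChar (latticeEmb d z) u : ℂ) = 0 := by
  obtain ⟨i, hi⟩ := Function.ne_iff.1 hz
  simp_rw [euclChar_apply, dotProduct, map_sum_fourierChar, coe_circle_prod, latticeEmb_apply]
  rw [unitCube, volume_pi, Measure.restrict_pi_pi]
  refine (integral_fintype_prod_eq_prod
    (fun (i : d) (t : ℝ) => (Real.fourierChar (z i * t) : ℂ))).trans ?_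
  exact Finset.prod_eq_zero (Finset.mem_univ i) (setIntegral_Ico_fourierChar hi)

/-- The lattice cube `a + [0,1)ᵈ`. -/
def cell {d : Type*} (a : d → ℤ) : Set (d → ℝ) := (fun u => u + latticeEmb d a) '' unitCube d

theorem mem_cell {d : Type*} {a : d → ℤ} {x : d → ℝ} : x ∈ cell a ↔ (fun i => ⌊x i⌋) = a := by
  constructor
  · rintro ⟨u, hu, rfl⟩
    ext i
    have := hu i trivial
    rw [Int.floor_eq_iff]
    simp only [Pi.add_apply, latticeEmb_apply]
    constructor <;> linarith [this.1, this.2]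
  · rintro rfl
    refine ⟨fun i => Int.fract (x i), fun i _ => ⟨Int.fract_nonneg _, Int.fract_lt_one _⟩, ?_⟩
    ext i
    simp [latticeEmb_apply]

/-- Membership in a union of lattice cubes depends only on the coordinatewise floor. -/
theorem mem_cubes {S : Set (Fin 3 → ℤ)} {x : Fin 3 → ℝ} :
    x ∈ cubes S ↔ (fun i => ⌊x i⌋) ∈ S := by
  constructor
  · rintro ⟨a, ha, u, hu, rfl⟩
    convert ha using 1
    exact mem_cell.1 ⟨u, fun i _ => hu i, by ext i; simp [latticeEmb_apply, add_comm]⟩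
  · intro h
    refine ⟨_, h, fun i => Int.fract (x i), fun i => ⟨Int.fract_nonneg _, Int.fract_lt_one _⟩, ?_⟩
    ext i; simp

theorem cubes_range {ι : Type*} (p : ι → Fin 3 → ℤ) : cubes (Set.range p) = ⋃ s, cell (p s) := by
  ext x
  simp only [mem_cubes, Set.mem_range, Set.mem_iUnion, mem_cell, eq_comm]

theorem measurableSet_cell {d : Type*} [Fintype d] (a : d → ℤ) : MeasurableSet (cell a) :=
  (measurableEmbedding_addRight _).measurableSet_image.2 (measurableSet_unitCube d)

theorem pairwise_disjoint_cell {d ι : Type*} {p : ι → d → ℤ} (hp : Function.Injective p) :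
    Pairwise (Function.onFun Disjoint fun s => cell (p s)) := fun _ _ hst =>
  Set.disjoint_left.2 fun _ hs ht => hst (hp ((mem_cell.1 hs).symm.trans (mem_cell.1 ht)))

theorem measurePreserving_add_latticeEmb {d : Type*} [Fintype d] (a : d → ℤ) :
    MeasurePreserving (fun u => u + latticeEmb d a) (volume.restrict (unitCube d))
      (volume.restrict (cell a)) :=
  (measurePreserving_add_right volume _).restrict_image_emb (measurableEmbedding_addRight _) _

theorem volume_cell {d : Type*} [Fintype d] (a : d → ℤ) : volume (cell a) = 1 := by
  rw [← Measure.restrict_apply_univ, ← (measurePreserving_add_latticeEmb a).measure_preimage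
    MeasurableSet.univ.nullMeasurableSet]
  simp [volume_unitCube]

theorem setIntegral_cubes {ι : Type*} [Fintype ι] {p : ι → Fin 3 → ℤ} (hp : Function.Injective p)
    {F : (Fin 3 → ℝ) → ℂ} (hF : IntegrableOn F (cubes (Set.range p))) :
    ∫ x in cubes (Set.range p), F x =
      ∑ s, ∫ u in unitCube (Fin 3), F (u + latticeEmb (Fin 3) (p s)) := by
  rw [cubes_range] at hF ⊢
  rw [integral_iUnion_fintype (fun s => measurableSet_cell _) (pairwise_disjoint_cell hp)
    (fun s => hF.mono_set (Set.subset_iUnion (fun s => cell (p s)) s))]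
  exact Finset.sum_congr rfl fun s _ => ((measurePreserving_add_latticeEmb (p s)).integral_comp
    (measurableEmbedding_addRight _) F).symm

theorem measurableSet_cubes_range {ι : Type*} [Countable ι] (p : ι → Fin 3 → ℤ) :
    MeasurableSet (cubes (Set.range p)) := by
  rw [cubes_range]
  exact MeasurableSet.iUnion fun s => measurableSet_cell _

theorem volume_cubes_range {ι : Type*} [Fintype ι] {p : ι → Fin 3 → ℤ}
    (hp : Function.Injective p) : volume (cubes (Set.range p)) = Fintype.card ι := by
  rw [cubes_range, measure_iUnion (pairwise_disjoint_cell hp) fun s => measurableSet_cell _]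
  simp [volume_cell, tsum_fintype]

/-- If the frequencies `θ` and the lattice points `p` form a complex Hadamard matrix, then
`θ + ℤ³` is a spectrum of the union of the unit cubes at the points `p`. -/
theorem isSpectrum_cubes {ι : Type*} [Fintype ι] [DecidableEq ι] {p : ι → Fin 3 → ℤ}
    (hp : Function.Injective p) {θ : ι → Fin 3 → ℝ}
    (hθ : (Matrix.of fun i s => (latticeChar (θ i) (p s) : ℂ)).IsHadamard) :
    IsSpectrum volume (cubes (Set.range p))
      (Set.range fun q : ι × (Fin 3 → ℤ) => euclChar (θ q.1 + latticeEmb (Fin 3) q.2)) := by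
  have hfin : volume (cubes (Set.range p)) ≠ ∞ := by
    rw [volume_cubes_range hp]; exact ENNReal.natCast_ne_top _
  have hcont : ∀ η : Fin 3 → ℝ, Continuous fun x => (euclChar η x : ℂ) := fun η =>
    continuous_subtype_val.comp (continuous_euclChar η)
  have hmem : ∀ η : Fin 3 → ℝ, MemLp (fun x => (euclChar η x : ℂ)) 2
      (volume.restrict (cubes (Set.range p))) := fun η =>
    memLp_circle_of_measure_ne_top hfin (hcont η).aestronglyMeasurable
  have hval : ∀ i (z : Fin 3 → ℤ) s u, euclChar (θ i + latticeEmb (Fin 3) z)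
      (u + latticeEmb (Fin 3) (p s)) =
      euclChar (θ i + latticeEmb (Fin 3) z) u * latticeChar (θ i) (p s) := fun i z s u => by
    rw [AddChar.map_add_eq_mul, euclChar_add _ _ (latticeEmb (Fin 3) (p s)), euclChar_latticeEmb,
      mul_one, latticeChar_apply]
  refine IsSpectrum.of_complete ?_ ?_ ?_ ?_
  · rintro _ ⟨q, rfl⟩
    exact continuous_euclChar _
  · rintro _ ⟨q, rfl⟩
    exact hmem _
  · rintro _ ⟨⟨i, z⟩, rfl⟩ _ ⟨⟨j, z'⟩, rfl⟩ hne
    refine (setIntegral_cubes hp (F := fun x => (euclChar (θ i + latticeEmb (Fin 3) z) x : ℂ) *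
      conj (euclChar (θ j + latticeEmb (Fin 3) z') x : ℂ))
      ((hmem _).integrable_mul (hmem _).star)).trans ?_
    simp only [hval, Circle.coe_mul, map_mul]
    have h1 : ∀ s, ∫ u in unitCube (Fin 3),
        (euclChar (θ i + latticeEmb (Fin 3) z) u : ℂ) * (latticeChar (θ i) (p s) : ℂ) *
          (conj (euclChar (θ j + latticeEmb (Fin 3) z') u : ℂ) *
            conj (latticeChar (θ j) (p s) : ℂ)) =
        (latticeChar (θ i) (p s) : ℂ) * conj (latticeChar (θ j) (p s) : ℂ) *
        ∫ u in unitCube (Fin 3), (euclChar (θ i + latticeEmb (Fin 3) z) u : ℂ) *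
          conj (euclChar (θ j + latticeEmb (Fin 3) z') u : ℂ) := fun s => by
      rw [← integral_const_mul]
      congr 1; ext u; ring
    simp_rw [h1, ← Finset.sum_mul]
    by_cases hij : i = j
    · subst hij
      have hz : z - z' ≠ 0 := fun h => hne (by rw [sub_eq_zero.1 h])
      refine mul_eq_zero_of_right _ ?_
      rw [← setIntegral_unitCube_euclChar hz]
      congr 1; ext u
      rw [← Circle.coe_inv_eq_conj, ← Circle.coe_mul, ← div_eq_mul_inv, ← euclChar_sub,
        add_sub_add_left_eq_sub, map_sub]
    · rw [sum_mul_conj_eq_zero_of_isHadamard (χ := fun i s => latticeChar (θ i) (p s)) hθ hij,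
        zero_mul]
  · intro f hf horth
    have hfs : ∀ s, MemLp (fun u => f (u + latticeEmb (Fin 3) (p s))) 2
        (volume.restrict (unitCube (Fin 3))) := fun s => by
      refine MemLp.comp_measurePreserving (g := f) ?_ (measurePreserving_add_latticeEmb (p s))
      refine hf.mono_measure (Measure.restrict_mono ?_ le_rfl)
      rw [cubes_range]
      exact Set.subset_iUnion (fun s => cell (p s)) s
    have hcube : volume (unitCube (Fin 3)) ≠ ∞ := by simp [volume_unitCube]
    -- Fold `f` onto the unit cube along the `i`-th frequency: the coefficient of the fold at `z`
    -- is the inner product of `f` with the character of frequency `θ i + z`.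
    have hg : ∀ i, (fun u => ∑ s, conj (euclChar (θ i) (u + latticeEmb (Fin 3) (p s)) : ℂ) *
        f (u + latticeEmb (Fin 3) (p s))) =ᵐ[volume.restrict (unitCube (Fin 3))] 0 := by
      intro i
      have hmul : ∀ s, MemLp (fun u => conj (euclChar (θ i) (u + latticeEmb (Fin 3) (p s)) : ℂ) *
          f (u + latticeEmb (Fin 3) (p s))) 2 (volume.restrict (unitCube (Fin 3))) := by
        intro s
        refine (hfs s).of_le ?_ ?_
        · refine AEStronglyMeasurable.mul ?_ (hfs s).aestronglyMeasurable
          exact (Complex.continuous_conj.comp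
            ((hcont _).comp (continuous_add_const _))).aestronglyMeasurable
        · refine Filter.Eventually.of_forall fun u => ?_
          rw [norm_mul, RCLike.norm_conj, Circle.norm_coe, one_mul]
      refine ae_eq_zero_of_fourier (memLp_finsetSum _ fun s _ => hmul s) fun z => ?_
      have h1 := (setIntegral_cubes hp
        (F := fun x => conj (euclChar (θ i + latticeEmb (Fin 3) z) x : ℂ) * f x)
        ((hmem _).star.integrable_mul hf)).symm.trans (horth _ ⟨(i, z), rfl⟩)
      rw [← h1, ← integral_finsetSum]
      · refine setIntegral_congr_fun (measurableSet_unitCube _) fun u _ => ?_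
        simp only [Finset.mul_sum]
        refine Finset.sum_congr rfl fun s _ => ?_
        simp only [euclChar_add _ _ (_ + _), AddChar.map_add_eq_mul (euclChar (latticeEmb _ _)),
          euclChar_latticeEmb, Circle.coe_mul, map_mul, Circle.coe_one, map_one]
        ring
      · intro s _
        exact MemLp.integrable_mul (memLp_circle_of_measure_ne_top hcube
          ((hcont _).comp (continuous_add_const _)).aestronglyMeasurable).star (hfs s)
    -- At almost every `u` all the folds vanish; inverting the Hadamard matrix, so do all
    -- `f (u + p s)`.
    have hz : ∀ᵐ u ∂volume.restrict (unitCube (Fin 3)),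
        ∀ s, f (u + latticeEmb (Fin 3) (p s)) = 0 := by
      filter_upwards [ae_all_iff.2 hg] with u hu
      refine congrFun (eq_zero_of_isHadamard hθ fun i => ?_)
      have h1 := hu i
      simp only [AddChar.map_add_eq_mul, Circle.coe_mul, map_mul, mul_assoc, ← Finset.mul_sum,
        Pi.zero_apply] at h1
      exact (mul_eq_zero.1 h1).resolve_left (by simp)
    rw [Filter.EventuallyEq, cubes_range, ae_restrict_iUnion_iff]
    intro s
    rw [← (measurePreserving_add_latticeEmb (p s)).map_eq,
      (measurableEmbedding_addRight _).ae_map_iff]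
    filter_upwards [hz] with u hu using hu s

theorem isSpectral_cubes_setAn (n : ℕ) : IsSpectral volume (cubes (setAn n)) := by
  rw [← range_pointAn]
  exact ⟨_, isSpectrum_cubes (pointAn_injective n) (isHadamard_An n)⟩

/-! ### Periodic structure of `A_n` and windows of side `8` -/

theorem measurableSet_floor_emod (a : ℤ) : MeasurableSet {t : ℝ | ⌊t⌋ % 8 = a} :=
  Int.measurable_floor (measurableSet_eq_fun (f := fun z : ℤ => z % 8) (g := fun _ => a)
    (measurable_of_countable _) measurable_const)

/-- By periodicity, every half-open interval of length `8` contains unit length of each residue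
class modulo `8`. -/
theorem volume_Ico_floor_emod {a : ℤ} (ha : 0 ≤ a ∧ a < 8) (d : ℝ) :
    volume ({t : ℝ | ⌊t⌋ % 8 = a} ∩ Set.Ico d (d + 8)) = 1 := by
  have hfd := fun d => isAddFundamentalDomain_Ioc (show (0 : ℝ) < 8 by norm_num) d volume
  have hIoc : ∀ d : ℝ, volume ({t : ℝ | ⌊t⌋ % 8 = a} ∩ Set.Ico d (d + 8)) =
      volume ({t : ℝ | ⌊t⌋ % 8 = a} ∩ Set.Ioc d (d + 8)) := fun d =>
    measure_congr (Filter.EventuallyEq.inter (ae_eq_refl _) Ico_ae_eq_Ioc)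
  rw [hIoc, (hfd d).measure_set_eq (hfd 0) (measurableSet_floor_emod a), ← hIoc]
  · have h : {t : ℝ | ⌊t⌋ % 8 = a} ∩ Set.Ico (0 : ℝ) (0 + 8) = Set.Ico (a : ℝ) (a + 1) := by
      ext t
      rw [← Int.preimage_floor_singleton]
      simp only [Set.mem_inter_iff, Set.mem_ofPred_eq, Set.mem_Ico, Set.mem_preimage,
        Set.mem_singleton_iff]
      have h1 : (0 : ℝ) ≤ t ↔ 0 ≤ ⌊t⌋ := by rw [Int.le_floor]; simp
      have h2 : t < 0 + 8 ↔ ⌊t⌋ < 8 := by rw [Int.floor_lt]; simp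
      rw [h1, h2]
      omega
    rw [h]; simp
  · rintro ⟨g, hg⟩
    obtain ⟨m, rfl⟩ := AddSubgroup.mem_zmultiples_iff.1 hg
    ext t
    have h1 : ⌊m • (8 : ℝ) + t⌋ = 8 * m + ⌊t⌋ := by
      have : m • (8 : ℝ) + t = ((8 * m : ℤ) : ℝ) + t := by push_cast; simp [mul_comm]
      rw [this, Int.floor_intCast_add]
    simp only [Set.mem_preimage, Set.mem_ofPred_eq, AddSubgroup.mk_vadd, vadd_eq_add]
    rw [h1]
    omega

/-- The half-open cube with lowest corner `c` and side `ℓ`. -/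
def box (c : Fin 3 → ℝ) (ℓ : ℝ) : Set (Fin 3 → ℝ) :=
  Set.univ.pi fun i => Set.Ico (c i) (c i + ℓ)

theorem mem_box {c x : Fin 3 → ℝ} {ℓ : ℝ} : x ∈ box c ℓ ↔ ∀ i, c i ≤ x i ∧ x i < c i + ℓ := by
  simp [box]

theorem measurableSet_box (c : Fin 3 → ℝ) (ℓ : ℝ) : MeasurableSet (box c ℓ) :=
  MeasurableSet.univ_pi fun _ => measurableSet_Ico

theorem volume_box (c : Fin 3 → ℝ) (ℓ : ℝ) : volume (box c ℓ) = ENNReal.ofReal ℓ ^ 3 := by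
  simp [box, volume_pi_pi, Real.volume_Ico]

/-- As the entries of `A` lie in `[0, 8)`, the set `A_n` is the part in `[0, 8n)³` of the
`8ℤ³`-periodic extension of `A`. -/
theorem mem_setAn {n : ℕ} {x : Fin 3 → ℤ} :
    x ∈ setAn n ↔ (∀ i, 0 ≤ x i ∧ x i < 8 * n) ∧ ∃ j, ∀ i, x i % 8 = matA i j := by
  constructor
  · rintro ⟨j, k, hk, rfl⟩
    refine ⟨fun i => ?_, j, fun i => ?_⟩ <;>
    · have := matA_mem i j
      have := hk i
      simp only [Set.mem_Ico] at this
      dsimp only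
      omega
  · rintro ⟨hx, j, hj⟩
    refine ⟨j, fun i => x i / 8, fun i => ?_, funext fun i => ?_⟩
    · have := hx i
      simp only [Set.mem_Ico]
      omega
    · have := hj i
      dsimp only
      omega

theorem cubes_setAn_subset_box (n : ℕ) : cubes (setAn n) ⊆ box 0 (8 * n) := by
  intro x hx
  rw [mem_box]
  intro i
  have h := (mem_setAn.1 (mem_cubes.1 hx)).1 i
  refine ⟨by simpa using Int.le_floor.1 h.1, ?_⟩
  simpa using Int.floor_lt.1 h.2

/-- Inside `[0, 8n)³` the set `A_n + [0,1)³` is `8ℤ³`-periodic, so it has volume `6` in every window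
of side `8`. -/
theorem volume_cubes_inter_box {n : ℕ} {d : Fin 3 → ℝ} (hd : ∀ i, 0 ≤ d i ∧ d i + 8 ≤ 8 * n) :
    volume (cubes (setAn n) ∩ box d 8) = 6 := by
  have h : cubes (setAn n) ∩ box d 8 = ⋃ j : Fin 6, Set.univ.pi fun i =>
      {t : ℝ | ⌊t⌋ % 8 = matA i j} ∩ Set.Ico (d i) (d i + 8) := by
    ext x
    simp only [Set.mem_inter_iff, mem_cubes, mem_setAn, mem_box, Set.mem_iUnion, Set.mem_univ_pi,
      Set.mem_ofPred_eq, Set.mem_Ico]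
    constructor
    · rintro ⟨⟨-, j, hj⟩, hx⟩
      exact ⟨j, fun i => ⟨hj i, hx i⟩⟩
    · rintro ⟨j, hj⟩
      refine ⟨⟨fun i => ⟨?_, ?_⟩, j, fun i => (hj i).1⟩, fun i => (hj i).2⟩
      · rw [Int.le_floor]
        push_cast
        linarith [(hd i).1, (hj i).2.1]
      · rw [Int.floor_lt]
        push_cast
        linarith [(hd i).2, (hj i).2.2]
  rw [h, measure_iUnion]
  · simp only [volume_pi_pi, volume_Ico_floor_emod (matA_mem _ _)]
    simp
  · intro j j' hne
    refine Set.disjoint_left.2 fun x hx hx' => hne (colA_injective (funext fun i => ?_))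
    have h1 := (hx i trivial).1
    have h2 := (hx' i trivial).1
    simp only [Set.mem_ofPred_eq] at h1 h2
    simp only [colA, ← h1, ← h2]
  · exact fun j => MeasurableSet.univ_pi fun i =>
      (measurableSet_floor_emod _).inter measurableSet_Ico

/-! ### Failure of tiling in `ℝ³` -/

theorem lintegral_indicator_translate {Ω B : Set (Fin 3 → ℝ)} (hΩ : MeasurableSet Ω)
    (t : Fin 3 → ℝ) :
    ∫⁻ y in B, Ω.indicator (fun _ => (1 : ℝ≥0∞)) (y - t) =
      volume ((fun y => y - t) ⁻¹' Ω ∩ B) := by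
  have hm : MeasurableSet ((fun y => y - t) ⁻¹' Ω) := (measurable_sub_const t) hΩ
  rw [← Measure.restrict_apply hm, ← lintegral_indicator_one hm]
  rfl

/-- Packing bound: translates in a tiling that lie in `B` have total volume at most that of `B`. -/
theorem card_mul_volume_le {Ω B : Set (Fin 3 → ℝ)} (hΩ : MeasurableSet Ω)
    {T : Set (Fin 3 → ℝ)}
    (hT : ∀ᵐ x, ∑' t : T, Ω.indicator (fun _ => (1 : ℝ≥0∞)) (x - (t : Fin 3 → ℝ)) = 1)
    (F : Finset T) (hF : ∀ t ∈ F, ∀ x, x - (t : Fin 3 → ℝ) ∈ Ω → x ∈ B) :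
    (F.card : ℝ≥0∞) * volume Ω ≤ volume B := by
  have h1 : ∀ t ∈ F, volume Ω =
      ∫⁻ y in B, Ω.indicator (fun _ => (1 : ℝ≥0∞)) (y - (t : Fin 3 → ℝ)) := by
    intro t ht
    rw [lintegral_indicator_translate hΩ,
      Set.inter_eq_left.2 (show (fun y => y - (t : Fin 3 → ℝ)) ⁻¹' Ω ⊆ B from hF t ht)]
    exact ((measurePreserving_sub_right volume (t : Fin 3 → ℝ)).measure_preimage
      hΩ.nullMeasurableSet).symm
  calc (F.card : ℝ≥0∞) * volume Ω = ∑ t ∈ F, volume Ω := by simp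
    _ = ∑ t ∈ F, ∫⁻ y in B, Ω.indicator (fun _ => (1 : ℝ≥0∞)) (y - (t : Fin 3 → ℝ)) :=
      Finset.sum_congr rfl h1
    _ = ∫⁻ y in B, ∑ t ∈ F, Ω.indicator (fun _ => (1 : ℝ≥0∞)) (y - (t : Fin 3 → ℝ)) :=
      (lintegral_finsetSum' F fun t _ => ((measurable_const.indicator hΩ).comp
        (measurable_sub_const _)).aemeasurable).symm
    _ ≤ ∫⁻ y in B, 1 := by
      refine lintegral_mono_ae (ae_restrict_of_ae ?_)
      filter_upwards [hT] with x hx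
      exact (ENNReal.sum_le_tsum F).trans hx.le
    _ = volume B := by simp

/-- Finitely many pairs of intervals of length `8`, of total length less than `ℓ`, do not cover
`[0, ℓ)`. -/
theorem exists_mem_Ico_avoiding {ι : Type*} (F : Finset ι) (τ : ι → ℝ) (m : ℝ) {ℓ : ℝ}
    (h : 16 * F.card < ℓ) : ∃ y ∈ Set.Ico 0 ℓ, ∀ t ∈ F,
      y ∉ Set.Ioo (τ t - 8) (τ t) ∧ y ∉ Set.Ioo (τ t + m - 8) (τ t + m) := by
  by_contra! hcon
  have hsub : Set.Ico 0 ℓ ⊆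
      ⋃ t ∈ F, (Set.Ioo (τ t - 8) (τ t) ∪ Set.Ioo (τ t + m - 8) (τ t + m)) := by
    intro y hy
    obtain ⟨t, ht, hyt⟩ := hcon y hy
    simp only [Set.mem_iUnion]
    exact ⟨t, ht, or_iff_not_imp_left.2 hyt⟩
  have h1 : ENNReal.ofReal ℓ ≤ ENNReal.ofReal (16 * F.card) := by
    calc ENNReal.ofReal ℓ = volume (Set.Ico 0 ℓ) := by simp
      _ ≤ ∑ t ∈ F, volume (Set.Ioo (τ t - 8) (τ t) ∪ Set.Ioo (τ t + m - 8) (τ t + m)) :=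
        (measure_mono hsub).trans (measure_biUnion_finset_le _ _)
      _ ≤ ∑ t ∈ F, (16 : ℝ≥0∞) := by
        refine Finset.sum_le_sum fun t _ => (measure_union_le _ _).trans ?_
        simp only [Real.volume_Ioo, sub_sub_cancel]
        norm_num
      _ = ENNReal.ofReal (16 * F.card) := by
        rw [ENNReal.ofReal_mul (by norm_num)]
        simp [mul_comm]
  rw [ENNReal.ofReal_le_ofReal_iff (by positivity)] at h1
  linarith

theorem volume_cubes_setAn (n : ℕ) : volume (cubes (setAn n)) = ((6 * n ^ 3 : ℕ) : ℝ≥0∞) := by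
  rw [← range_pointAn, volume_cubes_range (pointAn_injective n)]
  simp

/-- The central obstruction to tiling, stated up to null sets so that it covers both half-open and
open cubes. -/
theorem not_tiles_of_ae_eq_cubes {n : ℕ} (hn : 11000 ≤ n) {Ω : Set (Fin 3 → ℝ)}
    (hΩ : MeasurableSet Ω) (hsub : Ω ⊆ box 0 (8 * n)) (hae : Ω =ᵐ[volume] cubes (setAn n)) :
    ¬ Tiles volume Ω := by
  rintro ⟨T, hT⟩
  have hn' : (11000 : ℝ) ≤ n := by exact_mod_cast hn
  have hΩb : ∀ x t : Fin 3 → ℝ, x - t ∈ Ω → ∀ i, t i ≤ x i ∧ x i < t i + 8 * n := by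
    intro x t hx i
    have := mem_box.1 (hsub hx) i
    simp only [Pi.zero_apply, Pi.sub_apply] at this
    constructor <;> linarith
  -- The translates that can meet a window with lowest corner in `[0, 8n)³`. They lie in a cube of
  -- side `32n`, so there are at most `32³ / 6 < 5462` of them, whatever `n` is.
  let R : Set T := {t | ∀ i, -(8 * n : ℝ) < (t : Fin 3 → ℝ) i ∧ (t : Fin 3 → ℝ) i < 8 * n + 8}
  have hcard : ∀ F : Finset T, (F : Set T) ⊆ R → F.card ≤ 5461 := by
    intro F hF
    have h1 := card_mul_volume_le hΩ (B := box (fun _ => -(8 * n)) (32 * n)) hT F ?_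
    · rw [measure_congr hae, volume_cubes_setAn, volume_box] at h1
      have h2 : ENNReal.ofReal (32 * n) = ((32 * n : ℕ) : ℝ≥0∞) := by
        rw [← ENNReal.ofReal_natCast]; push_cast; rfl
      rw [h2] at h1
      have h3 : F.card * (6 * n ^ 3) ≤ (32 * n) ^ 3 := by exact_mod_cast h1
      by_contra! h4
      have h5 : 5462 * (6 * n ^ 3) ≤ F.card * (6 * n ^ 3) := Nat.mul_le_mul_right _ h4
      have h6 : 0 < n ^ 3 := by positivity
      rw [mul_pow] at h3
      omega
    · intro t ht x hx
      rw [mem_box]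
      intro i
      have h1 := hF ht i
      have h2 := hΩb x t hx i
      constructor <;> linarith [h1.1, h1.2, h2.1, h2.2]
  have hRfin : R.Finite := by
    by_contra hinf
    obtain ⟨F, hF, hFc⟩ := Set.Infinite.exists_subset_card_eq hinf 5462
    have := hcard F hF
    omega
  set F := hRfin.toFinset with hFdef
  have hFc : F.card ≤ 5461 := hcard F (by simp [hFdef])
  have hFc' : (F.card : ℝ) ≤ 5461 := by exact_mod_cast hFc
  -- A window cut by the boundary of no translate exists as `16 * 5461 < 8 * 11000 ≤ 8n`; its
  -- coordinates are chosen independently of each other.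
  choose x hx hxF using fun i : Fin 3 => exists_mem_Ico_avoiding F
    (fun t : T => (t : Fin 3 → ℝ) i) (8 * n) (ℓ := 8 * n) (by linarith)
  have hout : ∀ t : T, t ∉ F → ∀ y ∈ box x 8, y - (t : Fin 3 → ℝ) ∉ Ω := by
    intro t ht y hy hyt
    refine ht (hRfin.mem_toFinset.2 fun i => ?_)
    have h1 := mem_box.1 hy i
    have h2 := hΩb y t hyt i
    have h3 := hx i
    constructor <;> linarith [h3.1, h3.2, h1.1, h1.2, h2.1, h2.2]
  have hvol : ∀ t ∈ F, volume ((fun y => y - (t : Fin 3 → ℝ)) ⁻¹' Ω ∩ box x 8) = 0 ∨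
      volume ((fun y => y - (t : Fin 3 → ℝ)) ⁻¹' Ω ∩ box x 8) = 6 := by
    intro t ht
    by_cases hin : ∀ i, (t : Fin 3 → ℝ) i ≤ x i ∧ x i + 8 ≤ (t : Fin 3 → ℝ) i + 8 * n
    · right
      have h1 : (fun y => y - (t : Fin 3 → ℝ)) ⁻¹' Ω ∩ box x 8 =
          (fun y => y - (t : Fin 3 → ℝ)) ⁻¹' (Ω ∩ box (x - t) 8) := by
        ext y
        simp only [Set.mem_inter_iff, Set.mem_preimage, mem_box, Pi.sub_apply]
        refine and_congr_right fun _ => forall_congr' fun i => ?_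
        constructor <;> rintro ⟨_, _⟩ <;> constructor <;> linarith
      rw [h1, (measurePreserving_sub_right volume (t : Fin 3 → ℝ)).measure_preimage
        (hΩ.inter (measurableSet_box _ _)).nullMeasurableSet]
      refine (measure_congr (hae.inter (ae_eq_refl _))).trans (volume_cubes_inter_box fun i => ?_)
      have := hin i
      simp only [Pi.sub_apply]
      constructor <;> linarith [this.1, this.2]
    · left
      convert measure_empty (μ := (volume : Measure (Fin 3 → ℝ)))
      refine Set.eq_empty_of_forall_notMem fun y ⟨hyt, hy⟩ => hin fun i => ?_
      have h1 := mem_box.1 hy i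
      have h2 := hΩb y t hyt i
      have h3 := hxF i t ht
      simp only [Set.mem_Ioo, not_and, not_lt] at h3
      constructor
      · by_contra! h4
        linarith [h3.1 (by linarith)]
      · by_contra! h4
        linarith [h3.2 (by linarith)]
  have hsum : (512 : ℝ≥0∞) = ∑ t ∈ F, volume ((fun y => y - (t : Fin 3 → ℝ)) ⁻¹' Ω ∩ box x 8) := by
    calc (512 : ℝ≥0∞) = volume (box x 8) := by rw [volume_box]; norm_num
      _ = ∫⁻ y in box x 8, 1 := by simp
      _ = ∫⁻ y in box x 8, ∑ t ∈ F, Ω.indicator (fun _ => (1 : ℝ≥0∞)) (y - (t : Fin 3 → ℝ)) := by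
        refine lintegral_congr_ae ?_
        filter_upwards [ae_restrict_of_ae hT, ae_restrict_mem (measurableSet_box x 8)] with y hy hyb
        exact hy.symm.trans
          (tsum_eq_sum fun t ht => Set.indicator_of_notMem (hout t ht y hyb) _)
      _ = ∑ t ∈ F, ∫⁻ y in box x 8, Ω.indicator (fun _ => (1 : ℝ≥0∞)) (y - (t : Fin 3 → ℝ)) :=
        lintegral_finsetSum' F fun t _ => ((measurable_const.indicator hΩ).comp
          (measurable_sub_const _)).aemeasurable
      _ = _ := Finset.sum_congr rfl fun t _ => lintegral_indicator_translate hΩ _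
  have hmul : ∃ m : ℕ, ∑ t ∈ F, volume ((fun y => y - (t : Fin 3 → ℝ)) ⁻¹' Ω ∩ box x 8) =
      ((6 * m : ℕ) : ℝ≥0∞) := by
    classical
    refine Finset.sum_induction _ (fun v => ∃ m : ℕ, v = ((6 * m : ℕ) : ℝ≥0∞)) ?_ ⟨0, by simp⟩ ?_
    · rintro _ _ ⟨a, rfl⟩ ⟨b, rfl⟩
      exact ⟨a + b, by push_cast; ring⟩
    · intro t ht
      rcases hvol t ht with h | h
      · exact ⟨0, by simp [h]⟩
      · exact ⟨1, by simp [h]⟩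
  obtain ⟨m, hm⟩ := hmul
  rw [hm] at hsum
  have : 512 = 6 * m := by exact_mod_cast hsum
  omega

/-- A tiling of `ℤ³` by `S` is a tiling of `ℝ³` by `S + [0,1)³` with the same translates. -/
theorem Tiles.cubes {S : Set (Fin 3 → ℤ)} (hS : Tiles Measure.count S) :
    Tiles volume (cubes S) := by
  obtain ⟨T, hT⟩ := hS
  rw [Measure.ae_count_iff] at hT
  have hinj : Function.Injective (latticeEmb (Fin 3)) := fun a b h => funext fun i => by
    exact Int.cast_injective (α := ℝ) (congrFun h i)
  refine ⟨latticeEmb (Fin 3) '' T, Filter.Eventually.of_forall fun x => ?_⟩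
  refine Eq.trans ?_ (hT fun i => ⌊x i⌋)
  rw [← (Equiv.Set.image _ T hinj).tsum_eq]
  refine tsum_congr fun t => ?_
  have h : x - latticeEmb (Fin 3) t ∈ _root_.cubes S ↔ (fun i => ⌊x i⌋) - (t : Fin 3 → ℤ) ∈ S := by
    rw [mem_cubes]
    have : (fun i => ⌊(x - latticeEmb (Fin 3) t) i⌋) = (fun i => ⌊x i⌋) - (t : Fin 3 → ℤ) := by
      ext i; simp [latticeEmb_apply]
    rw [this]
  by_cases hx : (fun i => ⌊x i⌋) - (t : Fin 3 → ℤ) ∈ S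
  · rw [Set.indicator_of_mem hx]
    exact Set.indicator_of_mem (h.2 hx) _
  · rw [Set.indicator_of_notMem hx]
    exact Set.indicator_of_notMem (fun h' => hx (h.1 h')) _

/-! ### Open sets: removing the faces of the cubes -/

theorem IsSpectrum.congr_ae {G : Type*} [AddCommGroup G] [TopologicalSpace G]
    [MeasurableSpace G] {μ : Measure G} {Ω Ω' : Set G} {Λ : Set (AddChar G Circle)}
    (h : IsSpectrum μ Ω Λ) (hae : Ω =ᵐ[μ] Ω') : IsSpectrum μ Ω' Λ := by
  obtain ⟨h1, h2, h3, h4⟩ := h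
  rw [Measure.restrict_congr_set hae] at h2 h3 h4
  exact ⟨h1, h2, h3, h4⟩

/-- The union of open cubes `S + (0,1)³ ⊆ ℝ³` for `S ⊆ ℤ³`. -/
def openCubes (S : Set (Fin 3 → ℤ)) : Set (Fin 3 → ℝ) :=
  ⋃ a ∈ S, Set.univ.pi fun i => Set.Ioo (a i : ℝ) (a i + 1)

theorem cubes_eq_biUnion (S : Set (Fin 3 → ℤ)) :
    cubes S = ⋃ a ∈ S, Set.univ.pi fun i => Set.Ico (a i : ℝ) (a i + 1) := by
  ext x
  simp only [mem_cubes, Set.mem_iUnion, Set.mem_univ_pi, Set.mem_Ico, ← Int.floor_eq_iff]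
  constructor
  · exact fun h => ⟨_, h, fun i => rfl⟩
  · rintro ⟨a, ha, h⟩
    rwa [show (fun i => ⌊x i⌋) = a from funext h]

theorem isOpen_openCubes (S : Set (Fin 3 → ℤ)) : IsOpen (openCubes S) :=
  isOpen_biUnion fun _ _ => isOpen_set_pi Set.finite_univ fun _ _ => isOpen_Ioo

theorem openCubes_subset (S : Set (Fin 3 → ℤ)) : openCubes S ⊆ cubes S := by
  rw [cubes_eq_biUnion]
  exact Set.iUnion₂_mono fun a _ => Set.pi_mono fun i _ => Set.Ioo_subset_Ico_self

theorem openCubes_ae_eq (S : Set (Fin 3 → ℤ)) : openCubes S =ᵐ[volume] cubes S := by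
  rw [cubes_eq_biUnion]
  refine Filter.EventuallyEq.countable_bUnion S.to_countable fun a _ => ?_
  exact (Measure.univ_pi_Ioo_ae_eq_Icc (f := fun i => (a i : ℝ))
    (g := fun i => (a i + 1 : ℝ))).trans
    (Measure.univ_pi_Ico_ae_eq_Icc (f := fun i => (a i : ℝ)) (g := fun i => (a i + 1 : ℝ))).symm

theorem exists_isOpen_isSpectral_not_tiles :
    ∃ Ω : Set (Fin 3 → ℝ), Ω.Nonempty ∧ IsOpen Ω ∧ Bornology.IsBounded Ω ∧
      IsSpectral volume Ω ∧ ¬ Tiles volume Ω := by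
  have hsub := (openCubes_subset (setAn 11000)).trans (cubes_setAn_subset_box 11000)
  refine ⟨openCubes (setAn 11000), ?_, isOpen_openCubes _, ?_, ?_, ?_⟩
  · refine ⟨fun _ => 1 / 2, Set.mem_biUnion (x := 0) ?_ ?_⟩
    · exact ⟨0, 0, by simp, by ext i; fin_cases i <;> simp [matA]⟩
    · intro i _
      constructor <;> norm_num
  · refine (Metric.isBounded_Icc (0 : Fin 3 → ℝ) (fun _ => 8 * (11000 : ℕ))).subset
      (hsub.trans fun x hx => ⟨fun i => ?_, fun i => ?_⟩)
    · exact (mem_box.1 hx i).1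
    · simpa using (mem_box.1 hx i).2.le
  · obtain ⟨Λ, hΛ⟩ := isSpectral_cubes_setAn 11000
    exact ⟨Λ, hΛ.congr_ae (openCubes_ae_eq _).symm⟩
  · exact not_tiles_of_ae_eq_cubes le_rfl (isOpen_openCubes _).measurableSet hsub
      (openCubes_ae_eq _)

theorem not_tiles_cubes_setAn {n : ℕ} (hn : 11000 ≤ n) : ¬ Tiles volume (cubes (setAn n)) := by
  refine not_tiles_of_ae_eq_cubes hn ?_ (cubes_setAn_subset_box n) (ae_eq_refl _)
  rw [← range_pointAn]
  exact measurableSet_cubes_range _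

theorem mainTheorem2 :
    -- the explicit log-Hadamard matrix and its factorization mod 8
    IsLogHadamard matH ∧
    (∀ i j, ∃ z : ℤ, (8 : ℝ) * matH i j = (((matL * matA) i j : ℤ) : ℝ) + 8 * (z : ℝ)) ∧
    -- the six-element set in `(ℤ/8)³`
    setA.ncard = 6 ∧
    Nat.card (Fin 3 → ZMod 8) = 512 ∧ ¬ ((6 : ℕ) ∣ 512) ∧
    specL.ncard = 6 ∧
    IsSpectrum Measure.count setA specL ∧
    ¬ Tiles Measure.count setA ∧
    -- transfer to `ℤ³`, and then to `ℝ³`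
    (∀ n : ℕ, 1 ≤ n → IsSpectral Measure.count (setAn n)) ∧
    (∃ N : ℕ, 1 ≤ N ∧ ∀ n : ℕ, N ≤ n →
      ¬ Tiles Measure.count (setAn n) ∧
      IsSpectral volume (cubes (setAn n)) ∧
      ¬ Tiles volume (cubes (setAn n))) ∧
    -- spectral does not imply tile among the nonempty bounded open subsets of `ℝ³`
    (∃ Ω : Set (Fin 3 → ℝ), Ω.Nonempty ∧ IsOpen Ω ∧ Bornology.IsBounded Ω ∧
      IsSpectral volume Ω ∧ ¬ Tiles volume Ω) := by
  refine ⟨isLogHadamard_matH, eight_mul_matH, ncard_setA, card_zmod_eight_cubed, by norm_num,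
    ncard_specL, isSpectrum_setA, not_tiles_setA, fun n _ => isSpectral_setAn n,
    ⟨11000, by norm_num, fun n hn => ?_⟩, exists_isOpen_isSpectral_not_tiles⟩
  exact ⟨fun h => not_tiles_cubes_setAn hn h.cubes, isSpectral_cubes_setAn n,
    not_tiles_cubes_setAn hn⟩
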